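/- Let $d,M\in\mathbb N$ with $d\ge 1$, let $n\in\mathbb N_0$, and let $t_1,\dots,t_M\in[0,1)^d$ be pairwise distinct, with wrap-around separation distance $$q:=\min_{r\in\mathbb Z^d,\ j\neq \ell}\|t_j-t_\ell+r\|_\infty$$ (with $q=\infty$ if $M\le 1$, and $0\cdot\infty=0$). Put $z_j:=(e^{-2\pi i t_{j,1}},\dots,e^{-2\pi i t_{j,d}})\in\mathbb C^d$ and let $$A_n:=\bigl(z_j^k\bigr)_{j=1,\dots,M;\ k\in\mathbb N_0^d,\ \|k\|_\infty\le n}\in\mathbb C^{M\times(n+1)^d},\qquad z_j^k:=\prod_{s=1}^d (z_{j,s})^{k_s}.$$ For even $p\ge 2$ let $$C_p:=\left(\frac{\Gamma(\frac p2+1)\,\Gamma(p+\frac32)}{\pi^p\,\Gamma(\frac{p+3}2)}\right)^{1/p},$$ let $\sigma\approx 2.365$ be the first positive root of $\cos t\sinh t+\cosh t\sin t$, and let $$c_d:=\min\Bigl\{\,2\min_{p\in 2\mathbb N}C_p\, d^{1/p},\ \sqrt d,\ \tfrac{2\sigma}{\pi}\,d^{1/4}\Bigr\}.$$ If $nq>c_d$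 or $nq>3+2\log d$, then $\operatorname{rank}A_n=M$. -/

import Mathlib

open scoped ENNReal

noncomputable section

namespace SepVand

/-- The wrap-around separation distance of the nodes `t j` in `ℝ^d`: the infimum, over all pairs
`j ≠ ℓ` and all integer shifts `r`, of the max-norm of `t j - t ℓ + r` (the norm on `Fin d → ℝ` is
the max-norm). For at least two nodes this infimum is a minimum; for a single node
it is the minimum over the empty set, that is `∞`. -/
def separation {d M : ℕ} (t : Fin M → Fin d → ℝ) : ℝ≥0∞ :=
  ⨅ (j : Fin M) (l : Fin M) (_ : j ≠ l) (r : Fin d → ℤ),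
    ‖t j - t l + (fun s => (r s : ℝ))‖ₑ

/-- The point of the torus with parameter `t`: `z s = exp (-2 π i t s)`. -/
def torusPoint {d : ℕ} (t : Fin d → ℝ) (s : Fin d) : ℂ :=
  Complex.exp (-(2 * (Real.pi : ℂ) * Complex.I * (t s : ℂ)))

/-- The multivariate Vandermonde matrix of max-degree `n`: rows are indexed by the nodes, columns
by the exponents `k` in `ℕ^d` all of whose entries are at most `n`, and the `(j, k)` entry
is the monomial `z_j ^ k = ∏ s, (z_j s) ^ (k s)`. -/
def vandermonde {d M : ℕ} (n : ℕ) (t : Fin M → Fin d → ℝ) :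
    Matrix (Fin M) (Fin d → Fin (n + 1)) ℂ :=
  Matrix.of fun j k => ∏ s : Fin d, torusPoint (t j) s ^ (k s : ℕ)

/-- `C_p = (Γ(p/2 + 1) Γ(p + 3/2) / (π^p Γ((p + 3)/2)))^(1/p)`, used for even `p ≥ 2`. -/
def constC (p : ℕ) : ℝ :=
  (Real.Gamma ((p : ℝ) / 2 + 1) * Real.Gamma ((p : ℝ) + 3 / 2) /
    (Real.pi ^ p * Real.Gamma (((p : ℝ) + 3) / 2))) ^ (1 / (p : ℝ))

/-- The first positive root (about `2.365`) of `cos t * sinh t + cosh t * sin t`. -/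
def sigma : ℝ :=
  sInf {t : ℝ | 0 < t ∧ Real.cos t * Real.sinh t + Real.cosh t * Real.sin t = 0}

/-- The constant `c_d`: the smallest of `2 * min_p C_p * d^(1/p)` over the even `p ≥ 2` and its
improvements `√d` for `p = 2` and `(2 σ / π) * d^(1/4)` for `p = 4`. -/
def constc (d : ℕ) : ℝ :=
  min (2 * ⨅ r : ℕ+, constC (2 * (r : ℕ)) * (d : ℝ) ^ (1 / (2 * ((r : ℕ) : ℝ))))
    (min (Real.sqrt (d : ℝ)) (2 * sigma / Real.pi * (d : ℝ) ^ ((1 : ℝ) / 4)))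

end SepVand

end

/-! ### Fourier coefficients of windows supported on a short arc of the circle. -/

namespace SepVand

open MeasureTheory Set
open scoped ComplexConjugate

/-! Let `c` annihilate the rows. Then `S k = ∑ j, c j * z_j ^ k` vanishes on the cube `[0, n]^d`.
Put `N = n / 2` and weight `|S k|^2` by `(N^(2m) - ∑ s, (k s - N)^(2m)) * ∏ s, a (k s)` with `a ≥
0`. The weight is nonpositive outside the cube, so the weighted sum over `ℤ^d` is at most `0`.

Take for `a` the squared Fourier coefficients of a window on an arc of length `q`, modulated to
centre its spectrum at `N`. By Parseval, the sums of `a k` and `(k - N)^(2m) * a k` against a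
character are autocorrelations of the window and, up to a factor, of its `m`-th derivative; both
vanish at distance at least `q` from the integers. Distinct nodes have such a difference in some
coordinate, so only diagonal terms survive and the weighted sum is `D * ∑ |c j|^2`. If `D > 0` then
`c = 0` (`rank_vandermonde_of_weight`).

By `rank_vandermonde_of_window`, `D > 0` means that `d` times the Rayleigh quotient `∫ (φ^(m))^2 / ∫
φ^2` on `[-1, 1]` is below `(π n q / 2)^(2m)`. Cosine (`m = 1`), clamped beam mode (`m = 2`) and `(1
- u^2)^m` give the three terms of `c_d`; the last, with `m` about `log d / 2`, gives the logarithmic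
bound. -/

/-- A product over the coordinates of summable sequences sums to the product of the sums. -/
lemma hasSum_pi_prod {d : ℕ} (f : Fin d → ℤ → ℂ) (a : Fin d → ℂ)
    (h : ∀ s, HasSum (f s) (a s)) :
    HasSum (fun k : Fin d → ℤ => ∏ s, f s (k s)) (∏ s, a s) := by
  induction d with
  | zero => simp
  | succ d ih =>
    rw [← (Fin.consEquiv fun _ : Fin (d + 1) => ℤ).hasSum_iff, Fin.prod_univ_succ]
    have key : ∀ (u : ℤ → ℂ) (v : (Fin d → ℤ) → ℂ) (b c : ℂ), HasSum u b → HasSum v c →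
        HasSum (fun x : ℤ × (Fin d → ℤ) => u x.1 * v x.2) (b * c) := fun u v b c hu hv =>
      hu.mul hv (summable_mul_of_summable_norm hu.summable.norm hv.summable.norm)
    have := key _ _ _ _ (h 0) (ih (fun s => f s.succ) (fun s => a s.succ) fun s => h s.succ)
    convert this using 1
    funext x
    simp [Fin.consEquiv, Fin.prod_univ_succ]

/-- The Fourier transform of `g` restricted to `[-h, h]`, at the frequency `k`. -/
noncomputable def windowCoeff (h : ℝ) (g : ℝ → ℂ) (k : ℤ) : ℂ :=
  ∫ y in (-h)..h, Complex.exp (-(2 * Real.pi * Complex.I * k * y)) * g y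

/-- The function on the circle which is `g` on the arc `(-h, h)` and vanishes elsewhere. -/
noncomputable def windowFun (h : ℝ) (g : ℝ → ℂ) : UnitAddCircle → ℂ :=
  AddCircle.liftIoc 1 (-(1 / 2) : ℝ) ((Ioo (-h) h).indicator g)

lemma intervalIntegral_indicator_Ioo {h : ℝ} (h0 : 0 < h) (h1 : h ≤ 1 / 2) {E : Type*}
    [NormedAddCommGroup E] [NormedSpace ℝ E] (g : ℝ → E) :
    ∫ y in (-(1 / 2) : ℝ)..(-(1 / 2) + 1), (Ioo (-h) h).indicator g y = ∫ y in (-h)..h, g y := by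
  rw [intervalIntegral.integral_of_le (by norm_num), intervalIntegral.integral_of_le (by linarith),
    setIntegral_indicator measurableSet_Ioo, integral_Ioc_eq_integral_Ioo]
  congr 2
  refine inter_eq_right.2 fun x hx => ⟨?_, ?_⟩ <;> linarith [hx.1, hx.2]

lemma memLp_windowFun (h : ℝ) {g : ℝ → ℂ} (hg : Continuous g) :
    MemLp (windowFun h g) 2 (AddCircle.haarAddCircle (T := 1)) := by
  refine MemLp.haarAddCircle (MemLp.memLp_liftIoc ?_)
  refine MemLp.mono_measure Measure.restrict_le_self ?_
  rw [memLp_indicator_iff_restrict measurableSet_Ioo]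
  refine MemLp.mono_measure (Measure.restrict_mono Ioo_subset_Icc_self le_rfl) ?_
  obtain ⟨C, hC⟩ := isCompact_Icc.exists_bound_of_continuousOn hg.continuousOn
  exact MemLp.of_bound hg.aestronglyMeasurable C
    ((ae_restrict_iff' measurableSet_Icc).2 (ae_of_all _ hC))

lemma fourierCoeff_windowFun {h : ℝ} (h0 : 0 < h) (h1 : h ≤ 1 / 2) (g : ℝ → ℂ) (k : ℤ) :
    fourierCoeff (windowFun h g) k = windowCoeff h g k := by
  rw [fourierCoeff_eq_intervalIntegral _ _ (-(1 / 2) : ℝ), windowCoeff,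
    ← intervalIntegral_indicator_Ioo h0 h1]
  simp only [div_one, one_smul]
  refine intervalIntegral.integral_congr_ae (ae_of_all _ fun x hx => ?_)
  rw [uIoc_of_le (by norm_num)] at hx
  rw [windowFun, AddCircle.liftIoc_coe_apply hx, smul_eq_mul, fourier_coe_apply]
  by_cases hx' : x ∈ Ioo (-h) h
  · simp only [indicator_of_mem hx']
    congr 2
    push_cast
    ring
  · simp [indicator_of_notMem hx']

lemma integral_norm_sq_windowFun {h : ℝ} (h0 : 0 < h) (h1 : h ≤ 1 / 2) (g : ℝ → ℂ) :
    ∫ y, ‖windowFun h g y‖ ^ 2 ∂(AddCircle.haarAddCircle (T := 1)) =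
      ∫ y in (-h)..h, ‖g y‖ ^ 2 := by
  rw [AddCircle.integral_haarAddCircle, ← intervalIntegral_indicator_Ioo h0 h1]
  have := AddCircle.integral_liftIoc_eq_intervalIntegral (T := 1) (t := (-(1 / 2) : ℝ))
    (f := (Ioo (-h) h).indicator fun y => ‖g y‖ ^ 2)
  rw [← this]
  simp only [inv_one, one_smul]
  congr 1 with y
  rw [windowFun, ← AddCircle.liftIoc_comp_apply (g := fun z : ℂ => ‖z‖ ^ 2)]
  congr 1
  ext x
  by_cases hx' : x ∈ Ioo (-h) h <;> simp [hx']

lemma norm_lt_of_windowFun_ne_zero {h : ℝ} {g : ℝ → ℂ} {y : UnitAddCircle}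
    (hy : windowFun h g y ≠ 0) : ‖y‖ < h := by
  obtain ⟨x, hx, rfl⟩ := AddCircle.coe_image_Ioc_eq 1 (-(1 / 2) : ℝ) ▸ mem_univ y
  rw [windowFun, AddCircle.liftIoc_coe_apply hx] at hy
  have hx' : x ∈ Ioo (-h) h := by
    by_contra H
    exact hy (indicator_of_notMem H _)
  exact (QuotientAddGroup.norm_mk_le_norm).trans_lt (abs_lt.2 hx')

/-- Parseval in polarised form; with `G` a translate of `F` it computes autocorrelations. -/
lemma hasSum_conj_fourierCoeff_mul {F G : UnitAddCircle → ℂ}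
    (hF : MemLp F 2 (AddCircle.haarAddCircle (T := 1)))
    (hG : MemLp G 2 (AddCircle.haarAddCircle (T := 1))) :
    HasSum (fun k => conj (fourierCoeff F k) * fourierCoeff G k)
      (∫ y, conj (F y) * G y ∂(AddCircle.haarAddCircle (T := 1))) := by
  have := fourierBasis.hasSum_inner_mul_inner hF.toLp hG.toLp
  rw [L2.inner_def] at this
  have h1 : (fun k => conj (fourierCoeff F k) * fourierCoeff G k) = fun k =>
      inner ℂ hF.toLp (fourierBasis k) * inner ℂ (fourierBasis k) hG.toLp := by
    funext k
    rw [← fourierCoeff_congr_ae hF.coeFn_toLp, ← fourierCoeff_congr_ae hG.coeFn_toLp,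
      ← fourierBasis_repr, ← fourierBasis_repr, HilbertBasis.repr_apply_apply,
      HilbertBasis.repr_apply_apply, inner_conj_symm]
  have h2 : ∫ y, conj (F y) * G y ∂(AddCircle.haarAddCircle (T := 1)) =
      ∫ y, inner ℂ ((MemLp.toLp F hF : UnitAddCircle → ℂ) y)
        ((MemLp.toLp G hG : UnitAddCircle → ℂ) y) ∂(AddCircle.haarAddCircle (T := 1)) := by
    refine integral_congr_ae ?_
    filter_upwards [hF.coeFn_toLp, hG.coeFn_toLp] with y h1 h2
    simp [h1, h2, mul_comm]
  rw [h1, h2]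
  exact this

lemma fourierCoeff_translate (F : UnitAddCircle → ℂ) (x : UnitAddCircle) (k : ℤ) :
    fourierCoeff (fun y => F (y - x)) k = fourier (-k) x * fourierCoeff F k := by
  have := integral_sub_right_eq_self (μ := AddCircle.haarAddCircle (T := 1))
    (fun y => fourier (-k) (y + x) • F y) x
  simp only [sub_add_cancel] at this
  rw [fourierCoeff, this, fourierCoeff, ← integral_const_mul]
  congr 1 with y
  simp only [fourier_apply, smul_add, AddCircle.toCircle_add, Circle.coe_mul, smul_eq_mul]
  ring

lemma hasSum_norm_sq_windowCoeff {h : ℝ} (h0 : 0 < h) (h1 : h ≤ 1 / 2) {g : ℝ → ℂ}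
    (hg : Continuous g) :
    HasSum (fun k => ‖windowCoeff h g k‖ ^ 2) (∫ y in (-h)..h, ‖g y‖ ^ 2) := by
  have hF := memLp_windowFun h hg
  have := hasSum_conj_fourierCoeff_mul hF hF
  simp only [fourierCoeff_windowFun h0 h1, Complex.conj_mul'] at this
  rw [← integral_norm_sq_windowFun h0 h1]
  rw [← Complex.hasSum_ofReal]
  push_cast [← integral_complex_ofReal]
  exact this

/-- If `x` has distance at least `2 h` from the integers, then the window of half-length `h` and
its translate by `x` have disjoint supports on the circle. -/
lemma hasSum_norm_sq_windowCoeff_mul_exp {h : ℝ} (h0 : 0 < h) (h1 : h ≤ 1 / 2) {g : ℝ → ℂ}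
    (hg : Continuous g) {x : ℝ} (hx : ∀ r : ℤ, 2 * h ≤ |x + r|) :
    HasSum (fun k : ℤ => ((‖windowCoeff h g k‖ ^ 2 : ℝ) : ℂ) *
      Complex.exp (-(2 * Real.pi * Complex.I * k * x))) 0 := by
  have hF := memLp_windowFun h hg
  have hG : MemLp (fun y => windowFun h g (y - (x : UnitAddCircle))) 2
      (AddCircle.haarAddCircle (T := 1)) :=
    hF.comp_measurePreserving (measurePreserving_sub_right _ _)
  have hs := hasSum_conj_fourierCoeff_mul hF hG
  have hxn : 2 * h ≤ ‖(x : UnitAddCircle)‖ := by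
    rw [UnitAddCircle.norm_eq]
    simpa [sub_eq_add_neg] using hx (-round x)
  -- If both factors were nonzero, the triangle inequality would give `‖x‖ < 2 * h`; the arc is
  -- open, so distance exactly `2 * h` is allowed.
  have hz : ∀ y, conj (windowFun h g y) * windowFun h g (y - (x : UnitAddCircle)) = 0 := by
    intro y
    by_contra H
    have hy := norm_lt_of_windowFun_ne_zero (fun H' => H (by simp [H']) : windowFun h g y ≠ 0)
    have hy' := norm_lt_of_windowFun_ne_zero (right_ne_zero_of_mul H)
    have := norm_sub_le y (y - (x : UnitAddCircle))
    rw [sub_sub_cancel] at this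
    linarith
  simp only [hz, integral_zero, fourierCoeff_translate, fourierCoeff_windowFun h0 h1] at hs
  convert hs using 2 with k
  rw [mul_left_comm, Complex.conj_mul', fourier_coe_apply, mul_comm]
  push_cast
  congr 2
  ring

end SepVand

/-! ### The weighted quadratic form and the duality argument. -/

namespace SepVand

open scoped ComplexConjugate

/-- The character `exp (-2 π i k x)`. -/
noncomputable def char (k : ℤ) (x : ℝ) : ℂ :=
  Complex.exp (-(2 * Real.pi * Complex.I * k * x))

lemma norm_char (k : ℤ) (x : ℝ) : ‖char k x‖ = 1 := by
  rw [char, Complex.norm_exp]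
  simp

lemma char_zero (k : ℤ) : char k 0 = 1 := by simp [char]

lemma char_mul_conj (k : ℤ) (x y : ℝ) : char k x * conj (char k y) = char k (x - y) := by
  rw [char, char, char, ← Complex.exp_conj, ← Complex.exp_add]
  congr 1
  simp only [map_neg, map_mul, Complex.conj_ofReal, Complex.conj_I, map_intCast, map_ofNat]
  push_cast
  ring

lemma torusPoint_pow {d : ℕ} (t : Fin d → ℝ) (s : Fin d) (k : ℕ) :
    torusPoint t s ^ k = char k (t s) := by
  rw [torusPoint, char, ← Complex.exp_nat_mul]
  congr 1
  push_cast
  ring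

/-- The multiplier of the proof: the product weight `∏ s, a (k s)`, times a factor which is at most
zero outside the cube `[0, 2 N] ^ d`. -/
noncomputable def cubeWeight {d : ℕ} (N : ℝ) (m : ℕ) (a : ℤ → ℝ) (k : Fin d → ℤ) : ℝ :=
  (N ^ (2 * m) - ∑ s, ((k s : ℝ) - N) ^ (2 * m)) * ∏ s, a (k s)

lemma cubeWeight_nonpos {d : ℕ} {N : ℝ} (hN : 0 ≤ N) (m : ℕ) {a : ℤ → ℝ} (ha : ∀ k, 0 ≤ a k)
    {k : Fin d → ℤ} {s : Fin d} (hk : (k s : ℝ) ≤ 0 ∨ 2 * N ≤ k s) : cubeWeight N m a k ≤ 0 := by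
  refine mul_nonpos_of_nonpos_of_nonneg (sub_nonpos.2 ?_) (Finset.prod_nonneg fun s _ => ha _)
  have h1 : N ^ (2 * m) ≤ ((k s : ℝ) - N) ^ (2 * m) := by
    rw [pow_mul, pow_mul]
    refine pow_le_pow_left₀ (sq_nonneg _) (sq_le_sq.2 ?_) _
    rw [abs_of_nonneg hN]
    rcases hk with hk | hk
    · exact (le_abs.2 (Or.inr (by linarith)))
    · exact (le_abs.2 (Or.inl (by linarith)))
  exact h1.trans (Finset.single_le_sum (f := fun s => ((k s : ℝ) - N) ^ (2 * m))
    (fun s _ => (even_two_mul m).pow_nonneg _) (Finset.mem_univ s))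

/-- Every summand of the weight is a product over coordinates: the `s`-th one modifies only the
factor at `s`. Hence the sum factors. -/
lemma hasSum_cubeWeight_mul {d : ℕ} (N : ℝ) (m : ℕ) (a : ℤ → ℝ) (x : Fin d → ℝ)
    (α β : Fin d → ℂ) (hα : ∀ s, HasSum (fun k => (a k : ℂ) * char k (x s)) (α s))
    (hβ : ∀ s, HasSum (fun k : ℤ => ((((k : ℝ) - N) ^ (2 * m) * a k : ℝ) : ℂ) * char k (x s))
      (β s)) :
    HasSum (fun k : Fin d → ℤ => (cubeWeight N m a k : ℂ) * ∏ s, char (k s) (x s))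
      ((N : ℂ) ^ (2 * m) * ∏ s, α s - ∑ s, β s * ∏ s' ∈ Finset.univ.erase s, α s') := by
  have h1 := (hasSum_pi_prod _ _ hα).mul_left ((N : ℂ) ^ (2 * m))
  have h2 : ∀ s ∈ (Finset.univ : Finset (Fin d)), HasSum (fun k : Fin d → ℤ =>
      ((((k s : ℝ) - N) ^ (2 * m) * a (k s) : ℝ) : ℂ) * char (k s) (x s) *
        ∏ s' ∈ Finset.univ.erase s, (a (k s') : ℂ) * char (k s') (x s'))
      (β s * ∏ s' ∈ Finset.univ.erase s, α s') := by
    intro s _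
    have := hasSum_pi_prod (fun s' k => if s' = s then
      ((((k : ℝ) - N) ^ (2 * m) * a k : ℝ) : ℂ) * char k (x s') else (a k : ℂ) * char k (x s'))
      (fun s' => if s' = s then β s' else α s') (fun s' => by
        split_ifs with hs
        · exact hβ s'
        · exact hα s')
    have e : ∀ u v : Fin d → ℂ, ∏ s', (if s' = s then u s' else v s') =
        u s * ∏ s' ∈ Finset.univ.erase s, v s' := by
      intro u v
      rw [← Finset.mul_prod_erase _ _ (Finset.mem_univ s), if_pos rfl]
      congr 1
      exact Finset.prod_congr rfl fun s' hs' => if_neg (Finset.ne_of_mem_erase hs')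
    simpa only [e] using this
  refine (h1.sub (hasSum_sum h2)).congr_fun ?_
  intro k
  have h3 : ∀ s, ((((k s : ℝ) - N) ^ (2 * m) * a (k s) : ℝ) : ℂ) * char (k s) (x s) *
        ∏ s' ∈ Finset.univ.erase s, (a (k s') : ℂ) * char (k s') (x s') =
      (((k s : ℝ) - N) ^ (2 * m) : ℝ) * ∏ s', (a (k s') : ℂ) * char (k s') (x s') := by
    intro s
    rw [← Finset.mul_prod_erase _ _ (Finset.mem_univ s)]
    push_cast
    ring
  simp only [h3]
  rw [← Finset.sum_mul, ← sub_mul, Finset.prod_mul_distrib, cubeWeight]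
  push_cast
  ring

/-- If, for every `x` at sup-distance at least `q` from the integers, the exponential sums with
coefficients `a k` and `(k - n / 2) ^ (2 m) * a k` vanish, and the values at zero satisfy
`d * B < (n / 2) ^ (2 m) * A`, then the Vandermonde matrix of `q`-separated nodes has independent
rows. -/
lemma rank_vandermonde_of_weight {d M n m : ℕ} {t : Fin M → Fin d → ℝ} {q : ℝ}
    (hq : ∀ j l, j ≠ l → ∀ r : Fin d → ℤ, q ≤ ‖t j - t l + fun s => (r s : ℝ)‖)
    (hd : 0 < d) {a : ℤ → ℝ} (ha : ∀ k, 0 ≤ a k) {A B : ℝ} (hA : HasSum a A)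
    (hB : HasSum (fun k : ℤ => ((k : ℝ) - n / 2) ^ (2 * m) * a k) B)
    (hA0 : ∀ x : ℝ, (∀ r : ℤ, q ≤ |x + r|) → HasSum (fun k => (a k : ℂ) * char k x) 0)
    (hB0 : ∀ x : ℝ, (∀ r : ℤ, q ≤ |x + r|) → HasSum (fun k : ℤ =>
      ((((k : ℝ) - n / 2) ^ (2 * m) * a k : ℝ) : ℂ) * char k x) 0)
    (hAB : d * B < (n / 2 : ℝ) ^ (2 * m) * A) :
    (vandermonde n t).rank = M := by
  have hB' : 0 ≤ B := hB.nonneg fun k => mul_nonneg ((even_two_mul m).pow_nonneg _) (ha k)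
  have hA' : 0 < A := by
    have h := (by positivity : 0 ≤ (d : ℝ) * B).trans_lt hAB
    exact pos_of_mul_pos_right h (by positivity)
  set D : ℝ := A ^ (d - 1) * ((n / 2 : ℝ) ^ (2 * m) * A - d * B) with hD
  have hDpos : 0 < D := by
    have := sub_pos.2 hAB
    positivity
  have hdiag : HasSum (fun k : Fin d → ℤ => (cubeWeight (n / 2) m a k : ℂ) *
      ∏ s, char (k s) ((0 : Fin d → ℝ) s)) D := by
    have := hasSum_cubeWeight_mul (n / 2) m a (0 : Fin d → ℝ) (fun _ => A) (fun _ => B)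
      (fun s => by simpa [char_zero] using Complex.hasSum_ofReal.2 hA)
      (fun s => by simpa only [char_zero, Pi.zero_apply, mul_one] using Complex.hasSum_ofReal.2 hB)
    convert this using 1
    obtain ⟨e, rfl⟩ : ∃ e, d = e + 1 := ⟨d - 1, by omega⟩
    simp only [Finset.prod_const, Finset.card_univ, Fintype.card_fin, Finset.sum_const,
      Finset.card_erase_of_mem (Finset.mem_univ _), hD, nsmul_eq_mul, Nat.add_sub_cancel]
    push_cast
    ring
  have hoff : ∀ j l, j ≠ l → HasSum (fun k : Fin d → ℤ => (cubeWeight (n / 2) m a k : ℂ) *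
      ∏ s, char (k s) ((t j - t l) s)) 0 := by
    intro j l hjl
    -- Otherwise the integers that violate the bound in each coordinate combine into one shift of
    -- norm less than `q`.
    obtain ⟨s, hs⟩ : ∃ s, ∀ r : ℤ, q ≤ |(t j - t l) s + r| := by
      by_contra! H
      choose r hr using H
      refine (hq j l hjl r).not_gt ?_
      exact (pi_norm_lt_iff ((abs_nonneg _).trans_lt (hr ⟨0, hd⟩))).2 hr
    have hsum : ∀ x, Summable fun k => (a k : ℂ) * char k x := fun x =>
      Summable.of_norm (by simpa [norm_char, abs_of_nonneg (ha _)] using hA.summable)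
    have hsum' : ∀ x, Summable fun k : ℤ =>
        ((((k : ℝ) - n / 2) ^ (2 * m) * a k : ℝ) : ℂ) * char k x := fun x => by
      refine Summable.of_norm ?_
      simp only [norm_mul, norm_char, mul_one, Complex.norm_real]
      simpa only [norm_mul] using hB.summable.norm
    have := hasSum_cubeWeight_mul (n / 2) m a (t j - t l) _ _ (fun s => (hsum _).hasSum)
      (fun s => (hsum' _).hasSum)
    convert this using 1
    -- Every product contains either `α s` or `β s`, and both are zero at this coordinate.
    rw [Finset.prod_eq_zero (Finset.mem_univ s) (hA0 _ hs).tsum_eq, mul_zero, zero_sub, eq_comm,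
      neg_eq_zero]
    refine Finset.sum_eq_zero fun s' _ => ?_
    rcases eq_or_ne s s' with rfl | h
    · rw [(hB0 _ hs).tsum_eq, zero_mul]
    · rw [Finset.prod_eq_zero (Finset.mem_erase.2 ⟨h, Finset.mem_univ s⟩) (hA0 _ hs).tsum_eq,
        mul_zero]
  suffices h : LinearIndependent ℂ (vandermonde n t).row by
    simpa using h.rank_matrix
  rw [Fintype.linearIndependent_iff]
  intro c hc
  set S : (Fin d → ℤ) → ℂ := fun k => ∑ j, c j * ∏ s, char (k s) (t j s) with hS
  have hS0 : ∀ k : Fin d → ℤ, (∀ s, 0 ≤ k s ∧ k s ≤ n) → S k = 0 := by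
    intro k hk
    have := congrFun hc fun s => ⟨(k s).toNat, by have := hk s; omega⟩
    simp only [Finset.sum_apply, Pi.smul_apply, Matrix.row, vandermonde, Matrix.of_apply,
      torusPoint_pow, smul_eq_mul, Pi.zero_apply] at this
    rw [← this]
    refine Finset.sum_congr rfl fun j _ => ?_
    congr 1
    refine Finset.prod_congr rfl fun s _ => ?_
    rw [Int.toNat_of_nonneg (hk s).1]
  have hsum : HasSum (fun k => cubeWeight (n / 2) m a k * ‖S k‖ ^ 2) (D * ∑ j, ‖c j‖ ^ 2) := by
    rw [← Complex.hasSum_ofReal]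
    have : HasSum (fun k : Fin d → ℤ => ∑ j, ∑ l, c j * conj (c l) *
        ((cubeWeight (n / 2) m a k : ℂ) * ∏ s, char (k s) ((t j - t l) s)))
        (∑ j, ∑ l, c j * conj (c l) * if j = l then (D : ℂ) else 0) := by
      refine hasSum_sum fun j _ => hasSum_sum fun l _ => HasSum.mul_left _ ?_
      split_ifs with h
      · rw [h, sub_self]
        exact hdiag
      · exact hoff j l h
    convert this using 1
    · funext k
      push_cast
      rw [← Complex.mul_conj', hS]
      simp only [map_sum, map_mul, map_prod, Pi.sub_apply, ← char_mul_conj,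
        Finset.prod_mul_distrib]
      rw [Finset.sum_mul_sum, Finset.mul_sum]
      simp only [Finset.mul_sum]
      refine Finset.sum_congr rfl fun j _ => Finset.sum_congr rfl fun l _ => ?_
      ring
    · simp only [mul_ite, mul_zero, Finset.sum_ite_eq, Finset.mem_univ, if_true]
      push_cast
      rw [Finset.mul_sum]
      refine Finset.sum_congr rfl fun j _ => ?_
      rw [Complex.mul_conj', mul_comm]
  -- Termwise: `S` vanishes inside the cube and the weight is nonpositive outside.
  have hle : D * ∑ j, ‖c j‖ ^ 2 ≤ 0 := by
    refine hsum.nonpos fun k => ?_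
    by_cases hk : ∀ s, 0 ≤ k s ∧ k s ≤ n
    · simp [hS0 k hk]
    · push Not at hk
      obtain ⟨s, hs⟩ := hk
      refine mul_nonpos_of_nonpos_of_nonneg (cubeWeight_nonpos (by positivity) m ha (s := s) ?_)
        (by positivity)
      rcases lt_or_ge (k s) 0 with h | h
      · exact Or.inl (by exact_mod_cast h.le)
      · right
        have : (n : ℝ) < k s := by exact_mod_cast hs h
        linarith
  have hzero : ∑ j, ‖c j‖ ^ 2 = 0 :=
    le_antisymm (nonpos_of_mul_nonpos_right hle hDpos)
      (Finset.sum_nonneg fun _ _ => by positivity)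
  intro j
  have := (Finset.sum_eq_zero_iff_of_nonneg fun _ _ => by positivity).1 hzero j (Finset.mem_univ j)
  simpa using this

end SepVand

/-! ### From a window on `[-1, 1]` to a rank criterion. -/

namespace SepVand

open scoped ContDiff
open intervalIntegral

/-- The Fourier transform of `ψ` restricted to `[-1, 1]`. -/
noncomputable def unitFourier (ψ : ℝ → ℝ) (w : ℝ) : ℂ :=
  ∫ u in (-1 : ℝ)..1, Complex.exp (-(Complex.I * w * u)) * (ψ u : ℂ)

lemma unitFourier_deriv {ψ : ℝ → ℝ} (hψ : ContDiff ℝ 1 ψ) (h1 : ψ 1 = 0) (h2 : ψ (-1) = 0)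
    (w : ℝ) : unitFourier (deriv ψ) w = Complex.I * w * unitFourier ψ w := by
  have hd : ∀ u : ℝ, HasDerivAt (fun u : ℝ => Complex.exp (-(Complex.I * w * u)))
      (Complex.exp (-(Complex.I * w * u)) * (-(Complex.I * w))) u := by
    intro u
    have := (((hasDerivAt_id (u : ℂ)).const_mul (Complex.I * w)).neg.cexp).comp_ofReal
    simpa using this
  have hd' : ∀ u : ℝ, HasDerivAt (fun u : ℝ => (ψ u : ℂ)) ((deriv ψ u : ℝ) : ℂ) u := fun u =>
    ((hψ.differentiable (by simp)) u).hasDerivAt.ofReal_comp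
  have hc : Continuous (deriv ψ) := hψ.continuous_deriv (by simp)
  have := integral_mul_deriv_eq_deriv_mul (a := -1) (b := 1) (fun u _ => hd u) (fun u _ => hd' u)
    (Continuous.intervalIntegrable (by fun_prop) _ _)
    (Continuous.intervalIntegrable (by fun_prop) _ _)
  rw [unitFourier, this, h1, h2, unitFourier, ← integral_const_mul]
  simp only [Complex.ofReal_zero, mul_zero, sub_self, zero_sub, ← integral_neg]
  congr 1
  funext u
  ring

lemma unitFourier_iteratedDeriv {φ : ℝ → ℝ} (hφ : ContDiff ℝ ∞ φ) (w : ℝ) (m : ℕ)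
    (h1 : ∀ i < m, iteratedDeriv i φ 1 = 0) (h2 : ∀ i < m, iteratedDeriv i φ (-1) = 0) :
    unitFourier (iteratedDeriv m φ) w = (Complex.I * w) ^ m * unitFourier φ w := by
  induction m with
  | zero => simp
  | succ m ih =>
    rw [iteratedDeriv_succ, unitFourier_deriv _ (h1 m m.lt_succ_self) (h2 m m.lt_succ_self),
      ih (fun i hi => h1 i (hi.trans m.lt_succ_self)) (fun i hi => h2 i (hi.trans m.lt_succ_self)),
      pow_succ']
    · ring
    · rw [iteratedDeriv_eq_iterate]
      exact ContDiff.iterate_deriv' 1 m (hφ.of_le (by exact_mod_cast le_top))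

/-- The modulation shifts frequencies by `n / 2`, the midpoint of `[0, n]`; rescaling to `[-1, 1]`
produces the factor `h`. -/
lemma windowCoeff_modulated {h : ℝ} (h0 : 0 < h) (n : ℕ) (ψ : ℝ → ℝ) (k : ℤ) :
    windowCoeff h (fun y => Complex.exp (Complex.I * (Real.pi * n * y : ℝ)) * (ψ (y / h) : ℂ)) k =
      h * unitFourier ψ (2 * Real.pi * h * (k - n / 2)) := by
  have := integral_comp_div (a := -h) (b := h) (fun u : ℝ =>
    Complex.exp (-(Complex.I * (2 * Real.pi * h * (k - n / 2) : ℝ) * u)) * (ψ u : ℂ)) h0.ne'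
  rw [neg_div, div_self h0.ne'] at this
  rw [unitFourier, ← Complex.real_smul, ← this, windowCoeff]
  congr 1
  funext y
  rw [← mul_assoc, ← Complex.exp_add]
  congr 2
  have : (h : ℂ) ≠ 0 := by exact_mod_cast h0.ne'
  push_cast
  field_simp
  ring

lemma integral_norm_sq_modulated {h : ℝ} (h0 : 0 < h) (n : ℕ) (ψ : ℝ → ℝ) :
    ∫ y in (-h)..h, ‖Complex.exp (Complex.I * (Real.pi * n * y : ℝ)) * (ψ (y / h) : ℂ)‖ ^ 2 =
      h * ∫ u in (-1 : ℝ)..1, ψ u ^ 2 := by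
  have := integral_comp_div (a := -h) (b := h) (fun u : ℝ => ψ u ^ 2) h0.ne'
  rw [neg_div, div_self h0.ne', smul_eq_mul] at this
  rw [← this]
  congr 1
  funext y
  rw [norm_mul, mul_comm Complex.I, Complex.norm_exp_ofReal_mul_I, one_mul, Complex.norm_real,
    Real.norm_eq_abs, sq_abs]

/-- A window `φ` on `[-1, 1]` vanishing to order `m` at the end points, whose Rayleigh quotient for
the `2 m`-th order derivative is small enough, certifies that the Vandermonde matrix has full
rank. -/
lemma rank_vandermonde_of_window {d M n m : ℕ} {t : Fin M → Fin d → ℝ} {q : ℝ} (hq0 : 0 < q)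
    (hq1 : q ≤ 1) (hq : ∀ j l, j ≠ l → ∀ r : Fin d → ℤ, q ≤ ‖t j - t l + fun s => (r s : ℝ)‖)
    (hd : 0 < d) {φ : ℝ → ℝ} (hφ : ContDiff ℝ ∞ φ)
    (h1 : ∀ i < m, iteratedDeriv i φ 1 = 0) (h2 : ∀ i < m, iteratedDeriv i φ (-1) = 0)
    (h : d * ∫ u in (-1 : ℝ)..1, iteratedDeriv m φ u ^ 2 <
      (Real.pi * (n * q) / 2) ^ (2 * m) * ∫ u in (-1 : ℝ)..1, φ u ^ 2) :
    (vandermonde n t).rank = M := by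
  have hh0 : 0 < q / 2 := by positivity
  have hh1 : q / 2 ≤ 1 / 2 := by linarith
  have hcm : Continuous (iteratedDeriv m φ) := 
    hφ.continuous_iteratedDeriv m (by exact_mod_cast le_top)
  have hc := hφ.continuous
  set g : ℝ → ℂ := fun y =>
    Complex.exp (Complex.I * (Real.pi * n * y : ℝ)) * (φ (y / (q / 2)) : ℂ) with hg
  set g₂ : ℝ → ℂ := fun y =>
    Complex.exp (Complex.I * (Real.pi * n * y : ℝ)) * ((iteratedDeriv m φ (y / (q / 2)) : ℝ) : ℂ)
    with hg₂
  have hgc : Continuous g := by fun_prop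
  have hg₂c : Continuous g₂ := by fun_prop
  -- Each derivative in the rescaled variable multiplies the coefficient by `2 π i (q / 2) (k - n /
  -- 2)`; `κ` collects the part independent of `k` after squaring.
  set κ : ℝ := (2 * Real.pi * (q / 2)) ^ (2 * m) with hκ
  have hκ0 : 0 < κ := by positivity
  have hcoef : ∀ k : ℤ, κ⁻¹ * ‖windowCoeff (q / 2) g₂ k‖ ^ 2 =
      ((k : ℝ) - n / 2) ^ (2 * m) * ‖windowCoeff (q / 2) g k‖ ^ 2 := by
    intro k
    rw [inv_mul_eq_iff_eq_mul₀ hκ0.ne', hg, hg₂, windowCoeff_modulated hh0,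
      windowCoeff_modulated hh0, unitFourier_iteratedDeriv hφ _ m h1 h2, hκ]
    simp only [norm_mul, norm_pow, Complex.norm_I, Complex.norm_real, Real.norm_eq_abs,
      mul_pow, sq_abs, ← pow_mul, mul_comm m 2]
    rw [pow_mul |(k : ℝ) - n / 2|]
    simp only [pow_mul, sq_abs]
    ring
  refine rank_vandermonde_of_weight (m := m) hq hd (a := fun k => ‖windowCoeff (q / 2) g k‖ ^ 2)
    (fun k => by positivity) (hasSum_norm_sq_windowCoeff hh0 hh1 hgc)
    (B := κ⁻¹ * ∫ y in (-(q / 2))..(q / 2), ‖g₂ y‖ ^ 2) ?_ ?_ ?_ ?_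
  · simp only [← hcoef]
    exact (hasSum_norm_sq_windowCoeff hh0 hh1 hg₂c).mul_left _
  · intro x hx
    exact hasSum_norm_sq_windowCoeff_mul_exp hh0 hh1 hgc (by simpa [mul_div_cancel₀] using hx)
  · intro x hx
    have := (hasSum_norm_sq_windowCoeff_mul_exp hh0 hh1 hg₂c (x := x)
      (by simpa [mul_div_cancel₀] using hx)).mul_left ((κ⁻¹ : ℝ) : ℂ)
    simp only [← hcoef]
    rw [mul_zero] at this
    refine this.congr_fun fun k => ?_
    rw [Complex.ofReal_mul, mul_assoc, char]
  · rw [hg, hg₂, integral_norm_sq_modulated hh0, integral_norm_sq_modulated hh0]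
    have e : (Real.pi * (n * q) / 2) ^ (2 * m) = κ * (n / 2 : ℝ) ^ (2 * m) := by
      rw [hκ, ← mul_pow]
      congr 1
      ring
    rw [e] at h
    have := mul_lt_mul_of_pos_left h (mul_pos (inv_pos.2 hκ0) hh0)
    calc _ = _ := by ring
      _ < _ := this
      _ = _ := by field_simp

end SepVand

/-! ### Three explicit windows and their Rayleigh quotients. -/

namespace SepVand

open scoped ContDiff
open intervalIntegral Polynomial

lemma contDiff_iteratedDeriv {φ : ℝ → ℝ} (hφ : ContDiff ℝ ∞ φ) (m : ℕ) :
    ContDiff ℝ ∞ (iteratedDeriv m φ) := by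
  rw [iteratedDeriv_eq_iterate]
  exact ContDiff.iterate_deriv m hφ

/-- Integration by parts, `m` times, against a function vanishing to order `m` at the end points. -/
lemma integral_iteratedDeriv_mul {φ ψ : ℝ → ℝ} (hφ : ContDiff ℝ ∞ φ) (hψ : ContDiff ℝ ∞ ψ) (m : ℕ)
    (h1 : ∀ i < m, iteratedDeriv i φ 1 = 0) (h2 : ∀ i < m, iteratedDeriv i φ (-1) = 0) :
    ∫ u in (-1 : ℝ)..1, iteratedDeriv m φ u * ψ u =
      (-1) ^ m * ∫ u in (-1 : ℝ)..1, φ u * iteratedDeriv m ψ u := by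
  induction m generalizing ψ with
  | zero => simp
  | succ m ih =>
    have hc := contDiff_iteratedDeriv hφ m
    have hd := contDiff_iteratedDeriv hφ (m + 1)
    have hψ' : ContDiff ℝ ∞ (deriv ψ) := by simpa using contDiff_iteratedDeriv hψ 1
    have := integral_deriv_mul_eq_sub (a := -1) (b := 1)
      (u := iteratedDeriv m φ) (v := ψ) (u' := iteratedDeriv (m + 1) φ) (v' := deriv ψ)
      (fun u _ => by
        rw [iteratedDeriv_succ]
        exact (hc.differentiable (by simp) u).hasDerivAt)
      (fun u _ => (hψ.differentiable (by simp) u).hasDerivAt)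
      (hd.continuous.intervalIntegrable _ _) (hψ'.continuous.intervalIntegrable _ _)
    rw [h1 m m.lt_succ_self, h2 m m.lt_succ_self, zero_mul, zero_mul, sub_zero,
      integral_add (f := fun u => iteratedDeriv (m + 1) φ u * ψ u)
        (g := fun u => iteratedDeriv m φ u * deriv ψ u)
        ((hd.continuous.mul hψ.continuous).intervalIntegrable _ _)
        ((hc.continuous.mul hψ'.continuous).intervalIntegrable _ _),
      ih hψ' (fun i hi => h1 i (hi.trans m.lt_succ_self))
        (fun i hi => h2 i (hi.trans m.lt_succ_self)), ← iteratedDeriv_succ'] at this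
    rw [pow_succ]
    linarith

section Cosine

lemma hasDerivAt_cos_mul (c u : ℝ) :
    HasDerivAt (fun u => Real.cos (c * u)) (-(c * Real.sin (c * u))) u := by
  have := ((hasDerivAt_id u).const_mul c).cos
  simpa [mul_comm] using this

/-- The window is the lowest Dirichlet mode, with Rayleigh quotient `(π / 2)^2`. -/
lemma rank_vandermonde_of_sqrt_lt {d M n : ℕ} {t : Fin M → Fin d → ℝ} {q : ℝ} (hq0 : 0 < q)
    (hq1 : q ≤ 1) (hq : ∀ j l, j ≠ l → ∀ r : Fin d → ℤ, q ≤ ‖t j - t l + fun s => (r s : ℝ)‖)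
    (hd : 0 < d) (h : √(d : ℝ) < n * q) : (vandermonde n t).rank = M := by
  have hder : deriv (fun u => Real.cos (Real.pi / 2 * u)) =
      fun u => -(Real.pi / 2 * Real.sin (Real.pi / 2 * u)) :=
    funext fun u => (hasDerivAt_cos_mul _ u).deriv
  have hpi := Real.pi_pos
  have hpi2 : Real.pi / 2 ≠ 0 := by positivity
  refine rank_vandermonde_of_window (m := 1) (φ := fun u => Real.cos (Real.pi / 2 * u)) hq0 hq1 hq
    hd (by fun_prop) ?_ ?_ ?_
  · simp
  · simp
  · rw [iteratedDeriv_one, hder]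
    have e1 : ∫ u in (-1 : ℝ)..1, (-(Real.pi / 2 * Real.sin (Real.pi / 2 * u))) ^ 2 =
        (Real.pi / 2) ^ 2 := by
      have := integral_comp_mul_left (a := -1) (b := 1) (fun u => Real.sin u ^ 2) hpi2
      simp only [neg_sq, mul_pow, integral_const_mul]
      rw [this, integral_sin_sq]
      simp
    have e2 : ∫ u in (-1 : ℝ)..1, Real.cos (Real.pi / 2 * u) ^ 2 = 1 := by
      have := integral_comp_mul_left (a := -1) (b := 1) (fun u => Real.cos u ^ 2) hpi2
      rw [this, integral_cos_sq]
      simp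
    rw [e1, e2]
    have h2 : (d : ℝ) < (n * q) ^ 2 := by
      rwa [Real.sqrt_lt' ((Real.sqrt_nonneg _).trans_lt h)] at h
    have := mul_lt_mul_of_pos_right h2 (pow_pos (half_pos hpi) 2)
    calc _ < _ := this
      _ = _ := by ring

end Cosine

section Beam

/-- The function is positive on `(0, π / 2)` and changes sign on `[π / 2, π]`, so the roots stay
away from `0` and, the zero set being closed, the infimum is a root. -/
lemma sigma_spec : 0 < sigma ∧
    Real.cos sigma * Real.sinh sigma + Real.cosh sigma * Real.sin sigma = 0 := by
  set f : ℝ → ℝ := fun t => Real.cos t * Real.sinh t + Real.cosh t * Real.sin t with hf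
  have hc : Continuous f := by fun_prop
  have hpi := Real.pi_pos
  have hne : {t : ℝ | 0 < t ∧ f t = 0}.Nonempty := by
    have := intermediate_value_Icc' (a := Real.pi / 2) (b := Real.pi) (by linarith)
      hc.continuousOn
    obtain ⟨x, hx, hx0⟩ := this (show (0 : ℝ) ∈ _ from ⟨by
      have := Real.sinh_pos_iff.2 hpi
      simp [hf, this.le], by
      have := Real.cosh_pos (Real.pi / 2)
      simp [hf, this.le]⟩)
    exact ⟨x, by linarith [hx.1], hx0⟩
  have hlow : ∀ t ∈ {t : ℝ | 0 < t ∧ f t = 0}, Real.pi / 2 ≤ t := by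
    rintro x ⟨hx0, hx⟩
    by_contra! hlt
    have h1 := Real.cos_pos_of_mem_Ioo (x := x) ⟨by linarith, hlt⟩
    have h2 := Real.sinh_pos_iff.2 hx0
    have h3 := Real.cosh_pos x
    have h4 := Real.sin_pos_of_pos_of_lt_pi hx0 (by linarith)
    have : 0 < f x := by positivity
    exact this.ne' hx
  refine ⟨(half_pos hpi).trans_le (le_csInf hne hlow), ?_⟩
  have hmem : sigma ∈ closure {t : ℝ | 0 < t ∧ f t = 0} := csInf_mem_closure hne ⟨_, hlow⟩
  have hcl : IsClosed {t : ℝ | f t = 0} := isClosed_eq hc continuous_const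
  exact closure_minimal (fun t ht => ht.2) hcl hmem

/-- The lowest mode of a beam of length `2` clamped at both ends, for `c = sigma`. -/
noncomputable def beam (c u : ℝ) : ℝ :=
  Real.cosh c * Real.cos (c * u) - Real.cos c * Real.cosh (c * u)

lemma contDiff_beam (c : ℝ) : ContDiff ℝ ∞ (beam c) := by
  unfold beam
  fun_prop

lemma deriv_beam (c : ℝ) : deriv (beam c) = fun u =>
    -(c * (Real.cosh c * Real.sin (c * u) + Real.cos c * Real.sinh (c * u))) := by
  funext u
  have h1 := ((hasDerivAt_id u).const_mul c).cos.const_mul (Real.cosh c)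
  have h2 := ((hasDerivAt_id u).const_mul c).cosh.const_mul (Real.cos c)
  refine (h1.sub h2).deriv.trans ?_
  simp
  ring

lemma iteratedDeriv_two_beam (c : ℝ) : iteratedDeriv 2 (beam c) = fun u =>
    -(c ^ 2 * (Real.cosh c * Real.cos (c * u) + Real.cos c * Real.cosh (c * u))) := by
  rw [iteratedDeriv_succ, iteratedDeriv_one, deriv_beam]
  funext u
  have h1 := ((hasDerivAt_id u).const_mul c).sin.const_mul (Real.cosh c)
  have h2 := ((hasDerivAt_id u).const_mul c).sinh.const_mul (Real.cos c)
  refine (((h1.add h2).const_mul c).neg).deriv.trans ?_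
  simp
  ring

lemma iteratedDeriv_four_beam (c : ℝ) : iteratedDeriv 2 (iteratedDeriv 2 (beam c)) =
    fun u => c ^ 4 * beam c u := by
  have : iteratedDeriv 1 (iteratedDeriv 2 (beam c)) = fun u =>
      c ^ 3 * (Real.cosh c * Real.sin (c * u) - Real.cos c * Real.sinh (c * u)) := by
    rw [iteratedDeriv_one, iteratedDeriv_two_beam]
    funext u
    have h1 := ((hasDerivAt_id u).const_mul c).cos.const_mul (Real.cosh c)
    have h2 := ((hasDerivAt_id u).const_mul c).cosh.const_mul (Real.cos c)
    refine (((h1.add h2).const_mul (c ^ 2)).neg).deriv.trans ?_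
    simp
    ring
  rw [iteratedDeriv_succ, this]
  funext u
  have h1 := ((hasDerivAt_id u).const_mul c).sin.const_mul (Real.cosh c)
  have h2 := ((hasDerivAt_id u).const_mul c).sinh.const_mul (Real.cos c)
  refine ((h1.sub h2).const_mul (c ^ 3)).deriv.trans ?_
  simp [beam]
  ring

lemma rank_vandermonde_of_beam_lt {d M n : ℕ} {t : Fin M → Fin d → ℝ} {q : ℝ} (hq0 : 0 < q)
    (hq1 : q ≤ 1) (hq : ∀ j l, j ≠ l → ∀ r : Fin d → ℤ, q ≤ ‖t j - t l + fun s => (r s : ℝ)‖)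
    (hd : 0 < d) (h : 2 * sigma / Real.pi * (d : ℝ) ^ ((1 : ℝ) / 4) < n * q) :
    (vandermonde n t).rank = M := by
  obtain ⟨hs0, hs⟩ := sigma_spec
  have hpi := Real.pi_pos
  have hC := contDiff_beam sigma
  have h1 : ∀ i < 2, iteratedDeriv i (beam sigma) 1 = 0 := by
    intro i hi
    interval_cases i
    · simp [beam]
      ring
    -- The slope at the end point is `-sigma` times the expression defining `sigma`.
    · rw [iteratedDeriv_one, deriv_beam]
      simp only [mul_one]
      linear_combination -sigma * hs
  have h2 : ∀ i < 2, iteratedDeriv i (beam sigma) (-1) = 0 := by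
    intro i hi
    interval_cases i
    · simp [beam]
      ring
    · rw [iteratedDeriv_one, deriv_beam]
      simp only [mul_neg, mul_one, Real.sin_neg, Real.sinh_neg]
      linear_combination sigma * hs
  -- Two integrations by parts turn the energy into `∫ φ * φ''''`, and `beam` is an eigenfunction of
  -- the fourth derivative.
  have hE : ∫ u in (-1 : ℝ)..1, iteratedDeriv 2 (beam sigma) u ^ 2 =
      sigma ^ 4 * ∫ u in (-1 : ℝ)..1, beam sigma u ^ 2 := by
    have := integral_iteratedDeriv_mul hC (contDiff_iteratedDeriv hC 2) 2 h1 h2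
    simp only [← pow_two] at this
    rw [this, iteratedDeriv_four_beam, ← integral_const_mul, ← integral_const_mul]
    congr 1
    funext u
    ring
  have hN : 0 < ∫ u in (-1 : ℝ)..1, beam sigma u ^ 2 := by
    refine integral_pos (by norm_num) (hC.continuous.pow 2).continuousOn
      (fun u _ => sq_nonneg _) ⟨0, by norm_num, ?_⟩
    have h1 : 1 < Real.cosh sigma := Real.one_lt_cosh.2 hs0.ne'
    have h2 := Real.cos_le_one sigma
    have : 0 < beam sigma 0 := by
      simp only [beam, mul_zero, Real.cos_zero, Real.cosh_zero, mul_one]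
      linarith
    positivity
  refine rank_vandermonde_of_window (m := 2) hq0 hq1 hq hd hC h1 h2 ?_
  rw [hE, ← mul_assoc]
  refine mul_lt_mul_of_pos_right ?_ hN
  have h3 : sigma * (d : ℝ) ^ ((1 : ℝ) / 4) < Real.pi * (n * q) / 2 := by
    have := mul_lt_mul_of_pos_left h (half_pos hpi)
    calc _ = _ := by field_simp
      _ < _ := this
      _ = _ := by ring
  have h4 := pow_lt_pow_left₀ h3 (by positivity) (n := 4) (by norm_num)
  rw [mul_pow, ← Real.rpow_natCast ((d : ℝ) ^ ((1 : ℝ) / 4)),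
    ← Real.rpow_mul (by positivity)] at h4
  norm_num at h4
  linarith

end Beam

section Polynomial

/-- Substituting the cosine gives a Wallis integral of an odd power of the sine. -/
lemma integral_one_sub_sq_pow (k : ℕ) : ∫ u in (-1 : ℝ)..1, (1 - u ^ 2) ^ k =
    √Real.pi * Real.Gamma (k + 1) / Real.Gamma (k + 3 / 2) := by
  have h := integral_sin_pow_odd_mul_cos_pow (a := 0) (b := Real.pi) k 0
  simp only [pow_zero, mul_one, one_mul, Real.cos_pi, Real.cos_zero] at h
  rw [← h, integral_sin_pow_odd]
  clear h
  induction k with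
  | zero =>
    have : Real.Gamma (3 / 2) = √Real.pi / 2 := by
      rw [show (3 / 2 : ℝ) = 1 / 2 + 1 by norm_num, Real.Gamma_add_one (by norm_num),
        Real.Gamma_one_half_eq]
      ring
    have hpi := Real.sqrt_pos.2 Real.pi_pos
    simp [this]
    field_simp
  | succ k ih =>
    rw [Finset.prod_range_succ, ← mul_assoc, ih]
    push_cast
    rw [Real.Gamma_add_one (s := (k : ℝ) + 1) (by positivity),
      show (k : ℝ) + 1 + 3 / 2 = (k + 3 / 2) + 1 by ring,
      Real.Gamma_add_one (s := (k : ℝ) + 3 / 2) (by positivity)]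
    have := (Real.Gamma_pos_of_pos (s := (k : ℝ) + 3 / 2) (by positivity)).ne'
    field_simp

lemma iteratedDeriv_eval (P : ℝ[X]) (i : ℕ) :
    iteratedDeriv i (fun u => P.eval u) = fun u => (derivative^[i] P).eval u := by
  induction i with
  | zero => simp
  | succ i ih =>
    rw [iteratedDeriv_succ, ih, Function.iterate_succ_apply']
    funext u
    exact Polynomial.deriv _

/-- Only the leading term `(-1)^m X^(2m)` survives. -/
lemma iterate_derivative_bump (m : ℕ) :
    derivative^[2 * m] ((1 - X ^ 2 : ℝ[X]) ^ m) = C ((-1) ^ m * ((2 * m).factorial : ℝ)) := by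
  have e : (1 - X ^ 2 : ℝ[X]) ^ m = C ((-1) ^ m) * (X ^ 2 - C 1) ^ m := by
    rw [C_pow, ← mul_pow]
    congr 1
    simp
  have hmon : ((X ^ 2 - C 1 : ℝ[X]) ^ m).Monic := (monic_X_pow_sub_C 1 (by norm_num)).pow m
  have hdeg : ((X ^ 2 - C 1 : ℝ[X]) ^ m).natDegree = 2 * m := by
    rw [natDegree_pow, natDegree_X_pow_sub_C, mul_comm]
  rw [e, iterate_derivative_C_mul, C_mul]
  congr 1
  rw [eq_C_of_natDegree_le_zero ((natDegree_iterate_derivative _ _).trans (by rw [hdeg]; simp)),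
    coeff_iterate_derivative, zero_add, Nat.descFactorial_self]
  have : ((X ^ 2 - C 1 : ℝ[X]) ^ m).coeff (2 * m) = 1 := by
    rw [← hdeg]
    exact hmon.coeff_natDegree
  rw [this]
  simp

lemma constC_nonneg (p : ℕ) : 0 ≤ constC p := by
  have g1 := Real.Gamma_pos_of_pos (s := (p : ℝ) / 2 + 1) (by positivity)
  have g2 := Real.Gamma_pos_of_pos (s := (p : ℝ) + 3 / 2) (by positivity)
  have g3 := Real.Gamma_pos_of_pos (s := ((p : ℝ) + 3) / 2) (by positivity)
  rw [constC]
  positivity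

/-- The window `(1 - u^2)^m` has constant `2m`-th derivative, so its energy reduces to its integral;
the Rayleigh quotient is `(π * constC (2 * m))^(2m)`. -/
lemma rank_vandermonde_of_constC_lt {d M n : ℕ} {t : Fin M → Fin d → ℝ} {q : ℝ} (hq0 : 0 < q)
    (hq1 : q ≤ 1) (hq : ∀ j l, j ≠ l → ∀ r : Fin d → ℤ, q ≤ ‖t j - t l + fun s => (r s : ℝ)‖)
    (hd : 0 < d) {m : ℕ} (hm : 0 < m)
    (h : 2 * (constC (2 * m) * (d : ℝ) ^ (1 / (2 * (m : ℝ)))) < n * q) :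
    (vandermonde n t).rank = M := by
  have hpi := Real.pi_pos
  set P : ℝ[X] := (1 - X ^ 2) ^ m with hP
  have hC : ContDiff ℝ ∞ fun u => P.eval u := by simpa using P.contDiff_aeval (𝕜 := ℝ) ∞
  have hvan : ∀ x : ℝ, x ^ 2 = 1 → ∀ i < m, iteratedDeriv i (fun u => P.eval u) x = 0 := by
    intro x hx i hi
    rw [iteratedDeriv_eval]
    have := pow_sub_dvd_iterate_derivative_pow (1 - X ^ 2 : ℝ[X]) m i
    refine eval_eq_zero_of_dvd_of_eval_eq_zero this ?_
    simp [hx, Nat.sub_ne_zero_of_lt hi]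
  have h1 := hvan 1 (by norm_num)
  have h2 := hvan (-1) (by norm_num)
  have hN : ∫ u in (-1 : ℝ)..1, P.eval u ^ 2 =
      √Real.pi * Real.Gamma (2 * m + 1) / Real.Gamma (2 * m + 3 / 2) := by
    have := integral_one_sub_sq_pow (2 * m)
    push_cast at this
    rw [← this]
    congr 1
    funext u
    simp [hP, ← pow_mul, mul_comm]
  have hE : ∫ u in (-1 : ℝ)..1, iteratedDeriv m (fun u => P.eval u) u ^ 2 =
      Real.Gamma (2 * m + 1) * (√Real.pi * Real.Gamma (m + 1) / Real.Gamma (m + 3 / 2)) := by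
    have := integral_iteratedDeriv_mul hC (contDiff_iteratedDeriv hC m) m h1 h2
    simp only [← pow_two] at this
    rw [this, ← integral_one_sub_sq_pow]
    have e : iteratedDeriv m (iteratedDeriv m fun u => P.eval u) =
        fun _ => (-1) ^ m * ((2 * m).factorial : ℝ) := by
      have : iteratedDeriv m (fun u => P.eval u) = fun u => (derivative^[m] P).eval u :=
        iteratedDeriv_eval P m
      rw [this, iteratedDeriv_eval, ← Function.iterate_add_apply, ← two_mul,
        iterate_derivative_bump]
      simp
    have hG := Real.Gamma_nat_eq_factorial (2 * m)
    push_cast at hG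
    rw [e, integral_mul_const, hG]
    have : ∫ u in (-1 : ℝ)..1, P.eval u = ∫ u in (-1 : ℝ)..1, (1 - u ^ 2) ^ m := by
      simp [hP]
    rw [this]
    have : ((-1 : ℝ) ^ m) * (-1) ^ m = 1 := by rw [← mul_pow]; simp
    linear_combination
      (∫ u in (-1 : ℝ)..1, (1 - u ^ 2) ^ m) * ((2 * m).factorial : ℝ) * this
  refine rank_vandermonde_of_window (m := m) hq0 hq1 hq hd hC h1 h2 ?_
  have g1 := Real.Gamma_pos_of_pos (s := 2 * (m : ℝ) + 1) (by positivity)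
  have g2 := Real.Gamma_pos_of_pos (s := 2 * (m : ℝ) + 3 / 2) (by positivity)
  have g3 := Real.Gamma_pos_of_pos (s := (m : ℝ) + 1) (by positivity)
  have g4 := Real.Gamma_pos_of_pos (s := (m : ℝ) + 3 / 2) (by positivity)
  have hsq := Real.sqrt_pos.2 hpi
  rw [hE, hN]
  have hpow : ∀ x : ℝ, 0 ≤ x → (x ^ (1 / (2 * (m : ℝ)))) ^ (2 * m) = x := by
    intro x hx
    rw [← Real.rpow_natCast, ← Real.rpow_mul hx]
    push_cast
    rw [one_div_mul_cancel (by positivity), Real.rpow_one]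
  have hconst : constC (2 * m) ^ (2 * m) = Real.Gamma (m + 1) * Real.Gamma (2 * m + 3 / 2) /
      (Real.pi ^ (2 * m) * Real.Gamma (m + 3 / 2)) := by
    have e1 : (2 * (m : ℝ)) / 2 + 1 = m + 1 := by ring
    have e2 : (2 * (m : ℝ) + 3) / 2 = m + 3 / 2 := by ring
    rw [constC]
    push_cast
    rw [e1, e2, hpow _ (by positivity)]
  have hc0 := constC_nonneg (2 * m)
  have h3 := pow_lt_pow_left₀ (mul_lt_mul_of_pos_left h (half_pos hpi)) (by positivity)
    (n := 2 * m) (by omega)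
  have e3 : (Real.pi / 2 * (2 * (constC (2 * m) * (d : ℝ) ^ (1 / (2 * (m : ℝ)))))) ^ (2 * m) =
      d * (Real.Gamma (m + 1) * Real.Gamma (2 * m + 3 / 2) / Real.Gamma (m + 3 / 2)) := by
    rw [← mul_assoc, div_mul_cancel₀ _ (two_ne_zero), mul_pow, mul_pow, hconst,
      hpow _ (by positivity)]
    field_simp
  rw [e3] at h3
  have h4 := mul_lt_mul_of_pos_right h3
    (div_pos (mul_pos hsq g1) g2)
  calc _ = _ := by field_simp
    _ < _ := h4
    _ = _ := by ring

end Polynomial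

end SepVand

/-! ### The logarithmic bound and the conclusion. -/

namespace SepVand

/-- The ratio is the product of `x, ..., x + j - 1`, each at most `y`. -/
lemma Gamma_add_nat_le {x y : ℝ} (hx : 0 < x) (j : ℕ) (h : x + j ≤ y + 1) :
    Real.Gamma (x + j) ≤ y ^ j * Real.Gamma x := by
  induction j with
  | zero => simp
  | succ j ih =>
    push_cast at h ⊢
    have hy : x + j ≤ y := by linarith
    have hxj : 0 < x + j := by positivity
    rw [← add_assoc, Real.Gamma_add_one hxj.ne', pow_succ', mul_assoc]
    exact mul_le_mul hy (ih (by linarith)) (Real.Gamma_pos_of_pos hxj).le (hxj.le.trans hy)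

lemma constC_two_mul_le {m : ℕ} (hm : 0 < m) : constC (2 * m) ≤ 0.5036 * m := by
  have hm1 : (1 : ℝ) ≤ m := by exact_mod_cast hm
  have g4 := Real.Gamma_pos_of_pos (s := (m : ℝ) + 3 / 2) (by positivity)
  have e1 : (2 * (m : ℝ)) / 2 + 1 = m + 1 := by ring
  have e2 : (2 * (m : ℝ) + 3) / 2 = m + 3 / 2 := by ring
  have e3 : 2 * (m : ℝ) + 3 / 2 = (m + 3 / 2) + m := by ring
  rw [constC]
  push_cast
  rw [e1, e2, e3, one_div]
  refine (Real.rpow_inv_le_iff_of_pos ?_ (by positivity) (by positivity)).2 ?_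
  · have g2 := Real.Gamma_pos_of_pos (s := ((m : ℝ) + 3 / 2) + m) (by positivity)
    have g3 := Real.Gamma_pos_of_pos (s := (m : ℝ) + 1) (by positivity)
    positivity
  have h1 : Real.Gamma (m + 3 / 2 + m) ≤ (5 / 2 * m) ^ m * Real.Gamma (m + 3 / 2) :=
    Gamma_add_nat_le (by positivity) m (by linarith)
  have h2 : Real.Gamma (m + 1) ≤ (m : ℝ) ^ m := by
    rw [Real.Gamma_nat_eq_factorial]
    exact_mod_cast Nat.factorial_le_pow m
  -- The constant `0.5036` is just above `√(5 / 2) / 3.14`.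
  have h3 : (m : ℝ) * (5 / 2 * m) ≤ (0.5036 * m) ^ 2 * Real.pi ^ 2 := by
    have : (3.14 : ℝ) ^ 2 ≤ Real.pi ^ 2 :=
      pow_le_pow_left₀ (by norm_num) Real.pi_gt_d2.le 2
    nlinarith [sq_nonneg (m : ℝ)]
  have e4 : (0.5036 * (m : ℝ)) ^ (2 * (m : ℝ)) = (0.5036 * (m : ℝ)) ^ (2 * m) := by
    rw [← Real.rpow_natCast]
    push_cast
    rfl
  rw [e4, div_le_iff₀ (by positivity)]
  calc _ ≤ (m : ℝ) ^ m * ((5 / 2 * m) ^ m * Real.Gamma (m + 3 / 2)) := by gcongr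
    _ = ((m : ℝ) * (5 / 2 * m)) ^ m * Real.Gamma (m + 3 / 2) := by rw [mul_pow]; ring
    _ ≤ ((0.5036 * m) ^ 2 * Real.pi ^ 2) ^ m * Real.Gamma (m + 3 / 2) := by gcongr
    _ = _ := by rw [mul_pow, ← pow_mul, ← pow_mul]; ring

lemma exists_constC_le_log {d : ℕ} (hd : 0 < d) : ∃ m : ℕ, 0 < m ∧
    2 * (constC (2 * m) * (d : ℝ) ^ (1 / (2 * (m : ℝ)))) ≤ 3 + 2 * Real.log d := by
  have hlog : 0 ≤ Real.log d := Real.log_natCast_nonneg d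
  -- This makes `2 * m > log d`, so `d^(1/(2m)) ≤ e`, while `m ≤ log d / 2 + 1`; finally `2 * 0.5036
  -- * e < 3`.
  refine ⟨⌊Real.log d / 2⌋₊ + 1, Nat.succ_pos _, ?_⟩
  set m : ℕ := ⌊Real.log d / 2⌋₊ + 1 with hm
  have hm0 : (0 : ℝ) < m := by positivity
  have h1 : Real.log d / 2 < m := by
    rw [hm]
    push_cast
    exact Nat.lt_floor_add_one _
  have h2 : (m : ℝ) ≤ Real.log d / 2 + 1 := by
    rw [hm]
    push_cast
    linarith [Nat.floor_le (show 0 ≤ Real.log d / 2 by positivity)]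
  have h3 : (d : ℝ) ^ (1 / (2 * (m : ℝ))) ≤ 2.7182818286 := by
    rw [Real.rpow_def_of_pos (by exact_mod_cast hd)]
    refine (Real.exp_le_exp.2 (?_ : _ ≤ (1 : ℝ))).trans Real.exp_one_lt_d9.le
    rw [mul_one_div, div_le_one (by positivity)]
    linarith
  have h4 : constC (2 * m) * (d : ℝ) ^ (1 / (2 * (m : ℝ))) ≤ 0.5036 * m * 2.7182818286 :=
    mul_le_mul (constC_two_mul_le (Nat.succ_pos _)) h3 (by positivity) (by positivity)
  linarith

/-- Covers infinite separation; a single row is nonzero because its entry at `k = 0` is `1`. -/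
lemma rank_vandermonde_of_subsingleton {d M : ℕ} [Subsingleton (Fin M)] (n : ℕ)
    (t : Fin M → Fin d → ℝ) : (vandermonde n t).rank = M := by
  suffices h : LinearIndependent ℂ (vandermonde n t).row by
    simpa using h.rank_matrix
  refine (linearIndependent_subsingleton_index_iff _).2 fun j h => ?_
  simpa [vandermonde, Matrix.row] using congrFun h 0

theorem rank_vandermonde_of_constc_lt {d M n : ℕ} {t : Fin M → Fin d → ℝ} {q : ℝ} (hq0 : 0 < q)
    (hq1 : q ≤ 1) (hq : ∀ j l, j ≠ l → ∀ r : Fin d → ℤ, q ≤ ‖t j - t l + fun s => (r s : ℝ)‖)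
    (hd : 0 < d) (h : constc d < n * q) : (vandermonde n t).rank = M := by
  rw [constc, min_lt_iff, min_lt_iff] at h
  rcases h with h | h | h
  · rw [← lt_div_iff₀' two_pos] at h
    obtain ⟨r, hr⟩ := exists_lt_of_ciInf_lt h
    rw [lt_div_iff₀' two_pos] at hr
    exact rank_vandermonde_of_constC_lt hq0 hq1 hq hd r.pos hr
  · exact rank_vandermonde_of_sqrt_lt hq0 hq1 hq hd h
  · exact rank_vandermonde_of_beam_lt hq0 hq1 hq hd h

lemma separation_le {d M : ℕ} (t : Fin M → Fin d → ℝ) {j l : Fin M} (hjl : j ≠ l)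
    (r : Fin d → ℤ) : separation t ≤ ‖t j - t l + fun s => (r s : ℝ)‖ₑ :=
  iInf_le_of_le j (iInf_le_of_le l (iInf_le_of_le hjl (iInf_le _ r)))

end SepVand

theorem corollary2p5 (d : ℕ) (hd : 0 < d) (M n : ℕ) (t : Fin M → Fin d → ℝ)
    (ht : ∀ j s, t j s ∈ Set.Ico (0 : ℝ) 1) (hinj : Function.Injective t)
    (hsep : ENNReal.ofReal (SepVand.constc d) < (n : ENNReal) * SepVand.separation t ∨
      ENNReal.ofReal (3 + 2 * Real.log (d : ℝ)) < (n : ENNReal) * SepVand.separation t) :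
    (SepVand.vandermonde n t).rank = M := by
  rcases subsingleton_or_nontrivial (Fin M) with hM | hM
  · exact SepVand.rank_vandermonde_of_subsingleton n t
  obtain ⟨j, l, hjl⟩ := exists_pair_ne (Fin M)
  have hle := fun (j l : Fin M) (h : j ≠ l) r => SepVand.separation_le t h r
  have htop : SepVand.separation t ≠ ⊤ := ne_top_of_le_ne_top (by simp) (hle j l hjl 0)
  set q : ℝ := (SepVand.separation t).toReal with hq
  have hsq : SepVand.separation t = ENNReal.ofReal q := (ENNReal.ofReal_toReal htop).symm
  have hq' : ∀ j l, j ≠ l → ∀ r : Fin d → ℤ, q ≤ ‖t j - t l + fun s => (r s : ℝ)‖ := by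
    intro j l h r
    simpa using ENNReal.toReal_mono (by simp) (hle j l h r)
  have hnq : (n : ENNReal) * SepVand.separation t = ENNReal.ofReal (n * q) := by
    rw [hsq, ENNReal.ofReal_mul (by positivity), ENNReal.ofReal_natCast]
  rw [hnq] at hsep
  -- `ENNReal.ofReal` truncates at `0`, so either strict inequality forces positivity, and the
  -- comparison can then be made in `ℝ`.
  have hnq0 : 0 < n * q := by
    rcases hsep with h | h <;> exact ENNReal.ofReal_pos.1 (bot_le.trans_lt h)
  have hq0 : 0 < q := pos_of_mul_pos_right hnq0 (by positivity)
  -- Ensures that the arc of length `q` fits into the circle of length `1`.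
  have hq1 : q ≤ 1 := by
    refine (hq' j l hjl 0).trans ((pi_norm_le_iff_of_nonneg zero_le_one).2 fun s => ?_)
    have h1 := ht j s
    have h2 := ht l s
    simp only [Pi.add_apply, Pi.sub_apply, Pi.zero_apply, Int.cast_zero, add_zero,
      Real.norm_eq_abs, abs_le]
    constructor <;> linarith [h1.1, h1.2, h2.1, h2.2]
  rcases hsep with h | h
  · exact SepVand.rank_vandermonde_of_constc_lt hq0 hq1 hq' hd
      ((ENNReal.ofReal_lt_ofReal_iff hnq0).1 h)
  · obtain ⟨m, hm, hle⟩ := SepVand.exists_constC_le_log hd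
    exact SepVand.rank_vandermonde_of_constC_lt hq0 hq1 hq' hd hm
      (hle.trans_lt ((ENNReal.ofReal_lt_ofReal_iff hnq0).1 h))
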